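/- Let $\mathcal H$ be a complex Hilbert space and let $\mathcal P=\{P\in\mathcal L(\mathcal H): P=P^*=P^2\}$ be the set of orthogonal projections in $\mathcal H$, with the operator norm. Let $P,Q\in\mathcal P$ with $\|P-Q\|<1$, and put $l=\arcsin\|P-Q\|$. Then $l<\frac{\pi}{2}$, and there exists a $C^1$-smooth path $\gamma:[0,l]\to\mathcal P$ with $\gamma(0)=P$ and $\gamma(l)=Q$ such that, if $P\neq Q$ (equivalently, $l>0$), then $\|\dot\gamma(t)\|=1$ for all $t\in[0,l]$. Here smoothness and the derivative are with respect to the operator norm, with one-sided derivatives at the endpoints. -/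

import Mathlib

open NormedSpace selfAdjoint

section CStar

variable {A : Type*} [CStarAlgebra A]

/-! Put `s = 2p - 1`, `t = 2q - 1`. Since `‖ts - 1‖ = 2‖p - q‖ < 2`, `ts = exp(iy)` with `y`
self-adjoint and `‖y‖ = 2 arcsin ‖p - q‖ < π`. Conjugation by `s` inverts `ts`, so `y` anticommutes
with `s`; hence every `exp(iτy) s`, `τ` real, is a symmetry, and these run from `s` to `t`. Factors
that are unitary do not affect the norm, so the speed is constant. -/

lemma selfAdjoint.conj_expUnitary {s : A} (hs : s * s = 1) {x z : selfAdjoint A}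
    (hx : s * x * s = z) : s * (expUnitary x : A) * s = expUnitary z := by
  let +nondep : NormedAlgebra ℚ A := .restrictScalars ℚ ℂ A
  have h := exp_units_conj (⟨s, s, hs, hs⟩ : Aˣ) (Complex.I • (x : A))
  simp only [Units.inv_mk, mul_smul_comm, smul_mul_assoc, hx] at h
  exact h.symm

lemma selfAdjoint.coe_expUnitary_neg (x : selfAdjoint A) :
    (expUnitary (-x) : A) = star (expUnitary x : A) := by
  let +nondep : NormedAlgebra ℚ A := .restrictScalars ℚ ℂ A
  simp [star_exp, x.2.star_eq]

lemma IsStarProjection.symmetry_mul_self {p : A} (hp : IsStarProjection p) :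
    (2 * p - 1) * (2 * p - 1) = 1 := by
  have h : p * p = p := hp.isIdempotentElem
  have : (2 * p - 1) * (2 * p - 1) = 4 * (p * p) - 4 * p + 1 := by noncomm_ring
  rw [this, h, sub_self, zero_add]

lemma IsStarProjection.star_symmetry {p : A} (hp : IsStarProjection p) :
    star (2 * p - 1) = 2 * p - 1 := by
  have h : star p = p := hp.isSelfAdjoint
  simp only [two_mul, star_sub, star_add, star_one, h]

/-- A self-adjoint square root `s` of `1` gives the projection `(1 + s) / 2`. -/
lemma isStarProjection_half_one_add {s : A} (hs : s * s = 1) (hs' : star s = s) :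
    IsStarProjection ((1 / 2 : ℝ) • (1 + s)) where
  isIdempotentElem := by
    have : (1 + s) * (1 + s) = (2 : ℝ) • (1 + s) := by
      rw [two_smul, mul_add, add_mul, add_mul, hs, mul_one, one_mul, mul_one]
      abel
    rw [IsIdempotentElem, smul_mul_smul_comm, this, smul_smul]
    norm_num
  isSelfAdjoint := by
    simp [isSelfAdjoint_iff, hs']

lemma half_one_add_symmetry (p : A) : (1 / 2 : ℝ) • (1 + (2 * p - 1)) = p := by
  rw [add_sub_cancel, two_mul, ← two_smul ℝ p, smul_smul]
  norm_num

/-- A chord of length `2r` of the unit circle subtends the angle `2 arcsin r`. -/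
lemma Real.arccos_one_sub_two_mul_sq {r : ℝ} (h0 : 0 ≤ r) (h1 : r ≤ 1) :
    Real.arccos (1 - 2 * r ^ 2) = 2 * Real.arcsin r := by
  refine Real.arccos_eq_of_eq_cos ?_ ?_ ?_
  · linarith [Real.arcsin_nonneg.2 h0]
  · linarith [Real.arcsin_le_pi_div_two r]
  · rw [Real.cos_two_mul, Real.cos_sq', Real.sin_arcsin (by linarith) h1]
    ring

/-- The symmetries of two projections at distance less than `1` differ by the exponential of a
self-adjoint element which anticommutes with the first symmetry. -/
lemma IsStarProjection.exists_expUnitary_mul_symmetry {p q : A} (hp : IsStarProjection p)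
    (hq : IsStarProjection q) (hpq : ‖p - q‖ < 1) :
    ∃ y : selfAdjoint A, ‖y‖ = 2 * Real.arcsin ‖p - q‖ ∧
      (2 * p - 1) * (y : A) * (2 * p - 1) = -y ∧
      (expUnitary y : A) * (2 * p - 1) = 2 * q - 1 := by
  set s := 2 * p - 1 with hs
  set t := 2 * q - 1 with ht
  have hss : s * s = 1 := hp.symmetry_mul_self
  have hs' : star s = s := hp.star_symmetry
  have ht' : star t = t := hq.star_symmetry
  let su : unitary A := ⟨s, hp.two_mul_sub_one_mem_unitary⟩
  let tu : unitary A := ⟨t, hq.two_mul_sub_one_mem_unitary⟩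
  have hnorm : ‖((tu * star su : unitary A) - 1 : A)‖ = 2 * ‖p - q‖ := by
    rw [← Unitary.norm_sub_eq]
    change ‖t - s‖ = _
    have : t - s = (2 : ℝ) • (q - p) := by
      rw [hs, ht, two_smul]; noncomm_ring
    rw [this, norm_smul, norm_sub_rev]
    norm_num
  have hlt : ‖((tu * star su : unitary A) - 1 : A)‖ < 2 := by linarith
  set y := Unitary.argSelfAdjoint (tu * star su) with hy
  have hexp : (expUnitary y : A) = t * s := by
    rw [hy, expUnitary_argSelfAdjoint hlt]
    change t * star s = t * s
    rw [hs']
  have hynorm : ‖y‖ = 2 * Real.arcsin ‖p - q‖ := by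
    rw [hy, Unitary.norm_argSelfAdjoint hlt, hnorm,
      ← Real.arccos_one_sub_two_mul_sq (norm_nonneg _) hpq.le]
    ring_nf
  have hπ : ‖y‖ < Real.pi := by
    rw [hynorm]
    linarith [Real.arcsin_lt_pi_div_two.2 hpq]
  refine ⟨y, hynorm, ?_, by rw [hexp, mul_assoc, hss, mul_one]⟩
  -- `-(s * y * s)` has the same exponential and the same norm as `y`, so it equals `y`
  let z : selfAdjoint A := ⟨-(s * y * s), by
    rw [selfAdjoint.mem_iff]; simp [hs', mul_assoc, y.2.star_eq]⟩
  have hznorm : ‖z‖ = ‖y‖ := by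
    change ‖-(s * (y : A) * s)‖ = ‖(y : A)‖
    rw [norm_neg, CStarRing.norm_mul_mem_unitary _ su.2, CStarRing.norm_mem_unitary_mul _ su.2]
  have hzy : s * (z : A) * s = (-y : selfAdjoint A) := by
    change s * -(s * (y : A) * s) * s = -(y : A)
    calc s * -(s * (y : A) * s) * s = -((s * s) * y * (s * s)) := by noncomm_ring
      _ = -(y : A) := by rw [hss, one_mul, mul_one]
  have hz : expUnitary z = tu * star su := by
    rw [← expUnitary_argSelfAdjoint hlt, ← hy]
    ext
    have h := conj_expUnitary hss hzy
    rw [coe_expUnitary_neg, hexp, star_mul, hs', ht'] at h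
    calc (expUnitary z : A) = (s * s) * expUnitary z * (s * s) := by rw [hss, one_mul, mul_one]
      _ = s * (s * expUnitary z * s) * s := by noncomm_ring
      _ = (s * s) * t * s := by rw [h]; noncomm_ring
      _ = expUnitary y := by rw [hss, one_mul, hexp]
  -- The exponential is injective on norm less than `π`.
  have h := argSelfAdjoint_expUnitary (hznorm.trans_lt hπ)
  rw [hz, ← hy] at h
  have h' : (y : A) = -(s * y * s) := congrArg Subtype.val h
  rw [eq_neg_iff_add_eq_zero, add_comm, ← eq_neg_iff_add_eq_zero] at h'
  exact h'

/-- If `s` is a self-adjoint unitary anticommuting with the self-adjoint element `y`, then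
`(1 + exp (I • y) * s) / 2` is a projection. -/
lemma isStarProjection_half_one_add_expUnitary_mul {s : A} (hss : s * s = 1) (hs' : star s = s)
    {y : selfAdjoint A} (hy : s * (y : A) * s = -y) :
    IsStarProjection ((1 / 2 : ℝ) • (1 + (expUnitary y : A) * s)) := by
  have h : s * (expUnitary y : A) * s = star (expUnitary y : A) := by
    rw [← coe_expUnitary_neg]
    exact conj_expUnitary hss hy
  refine isStarProjection_half_one_add ?_ ?_
  · rw [mul_assoc, ← mul_assoc s, h, Unitary.mul_star_self_of_mem (expUnitary y).2]
  · rw [star_mul, hs', ← h, mul_assoc s, ← mul_assoc, hss, one_mul]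

/-- Two projections at distance less than `1` are joined by a smooth path of projections,
parametrized by arc length, of length `arcsin ‖p - q‖`. -/
lemma IsStarProjection.exists_unit_speed_path {p q : A} (hp : IsStarProjection p)
    (hq : IsStarProjection q) (hpq : ‖p - q‖ < 1) (hne : p ≠ q) :
    ∃ γ γ' : ℝ → A, (∀ t, HasDerivAt γ (γ' t) t) ∧ Continuous γ' ∧
      (∀ t, IsStarProjection (γ t)) ∧ γ 0 = p ∧ γ (Real.arcsin ‖p - q‖) = q ∧
      ∀ t, ‖γ' t‖ = 1 := by
  let +nondep : NormedAlgebra ℚ A := .restrictScalars ℚ ℂ A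
  obtain ⟨y, hynorm, hys, hexp⟩ := hp.exists_expUnitary_mul_symmetry hq hpq
  have hl : 0 < Real.arcsin ‖p - q‖ := Real.arcsin_pos.2 (norm_pos_iff.2 (sub_ne_zero.2 hne))
  set l := Real.arcsin ‖p - q‖
  have hss := hp.symmetry_mul_self
  have hsu := hp.two_mul_sub_one_mem_unitary
  have hs' := hp.star_symmetry
  have hs : (1 / 2 : ℝ) • (1 + (2 * p - 1)) = p := half_one_add_symmetry p
  set s := 2 * p - 1
  -- As `‖y‖ = 2l`, this scaling gives `‖w‖ = 2`, cancelling the factor `1 / 2` in the path.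
  set w : A := Complex.I • (l⁻¹ • (y : A)) with hw
  have hu (t : ℝ) : exp (t • w) = (expUnitary ((t * l⁻¹) • y) : A) := by
    rw [expUnitary_coe, hw, smul_comm t, smul_smul]
    rfl
  have hwnorm : ‖w‖ = 2 := by
    change ‖(y : A)‖ = _ at hynorm
    rw [hw, norm_smul, norm_smul, hynorm, Complex.norm_I, norm_inv, Real.norm_of_nonneg hl.le]
    field_simp
  refine ⟨fun t ↦ (1 / 2 : ℝ) • (1 + exp (t • w) * s),
    fun t ↦ (1 / 2 : ℝ) • (exp (t • w) * w * s), fun t ↦ ?_, ?_, fun t ↦ ?_, ?_, ?_, fun t ↦ ?_⟩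
  · exact (((hasDerivAt_exp_smul_const w t).mul_const s).const_add 1).const_smul (1 / 2 : ℝ)
  · have := exp_continuous (𝔸 := A)
    fun_prop
  · dsimp only
    rw [hu]
    refine isStarProjection_half_one_add_expUnitary_mul hss hs' ?_
    change s * ((t * l⁻¹) • (y : A)) * s = -((t * l⁻¹) • (y : A))
    rw [mul_smul_comm, smul_mul_assoc, hys, smul_neg]
  · simpa using hs
  · dsimp only
    rw [hu, mul_inv_cancel₀ hl.ne', one_smul, hexp, half_one_add_symmetry]
  · dsimp only
    rw [hu, norm_smul, CStarRing.norm_mul_mem_unitary _ hsu, CStarRing.norm_coe_unitary_mul, hwnorm]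
    norm_num

end CStar

theorem lemma3p5 {H : Type*} [NormedAddCommGroup H] [InnerProductSpace ℂ H] [CompleteSpace H]
    (P Q : H →L[ℂ] H) (hP : IsStarProjection P) (hQ : IsStarProjection Q) (hPQ : ‖P - Q‖ < 1) :
    Real.arcsin ‖P - Q‖ < Real.pi / 2 ∧
    ∃ γ : ℝ → (H →L[ℂ] H),
      ContDiffOn ℝ 1 γ (Set.Icc 0 (Real.arcsin ‖P - Q‖)) ∧
      (∀ t ∈ Set.Icc 0 (Real.arcsin ‖P - Q‖), IsStarProjection (γ t)) ∧
      γ 0 = P ∧ γ (Real.arcsin ‖P - Q‖) = Q ∧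
      (P ≠ Q → ∀ t ∈ Set.Icc 0 (Real.arcsin ‖P - Q‖),
        ‖derivWithin γ (Set.Icc 0 (Real.arcsin ‖P - Q‖)) t‖ = 1) := by
  refine ⟨Real.arcsin_lt_pi_div_two.2 hPQ, ?_⟩
  -- Here `l = 0`, so no rescaling by `l⁻¹` is possible.
  by_cases hne : P = Q
  · exact ⟨fun _ ↦ P, contDiffOn_const, fun _ _ ↦ hP, rfl, hne, fun h ↦ absurd hne h⟩
  have hl : 0 < Real.arcsin ‖P - Q‖ := Real.arcsin_pos.2 (norm_pos_iff.2 (sub_ne_zero.2 hne))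
  obtain ⟨γ, γ', hγ, hγ', hproj, h0, h1, hnorm⟩ := hP.exists_unit_speed_path hQ hPQ hne
  refine ⟨γ, ContDiff.contDiffOn ?_, fun t _ ↦ hproj t, h0, h1, fun _ t ht ↦ ?_⟩
  · rw [contDiff_one_iff_deriv, funext fun t ↦ (hγ t).deriv]
    exact ⟨fun t ↦ (hγ t).differentiableAt, hγ'⟩
  · rw [(hγ t).hasDerivWithinAt.derivWithin (uniqueDiffOn_Icc hl t ht), hnorm]
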